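/- Let $W=(W_t)_{t\in\mathbb R}$ be a two-sided standard Brownian motion ($W_t=W^1_t$ for $t\ge 0$ and $W_t=W^2_{-t}$ for $t<0$, with $W^1,W^2$ independent standard Brownian motions on $[0,\infty)$), and let $g\in L^2(\mathbb R)$ be a non-negative kernel with $g(x)=0$ for $x\le 0$ which is not almost everywhere zero. Let $$X_t=\int_{-\infty}^t g(t-s)\,\mathrm dW_s,\qquad t\in\mathbb R,$$ which is the Gaussian core of any Brownian semistationary process $Y_t=\int_{-\infty}^t g(t-s)\sigma_s\,\mathrm dW_s$ with kernel $g$ and driving Brownian motion $W$. Put $\gamma(h)=\int_0^\infty g(x)g(x+|h|)\,\mathrm dx$ for $h\in\mathbb R$. Fix $\Delta_n>0$ and assume that $$\sum_{k=-\infty}^{\infty}\Bigl(\int_{-\infty}^{\infty}|g(s)g(s+k\Delta_n)|\,\mathrm ds\Bigr)^2<\infty .$$ Let $$\tau_n=\sqrt{\mathbb E[(X_{\Delta_n}-X_0)^2]},\qquad \tau_n^N=\sqrt{\frac1N\sum_{i=1}^N\bigl(X_{i\Delta_n}-X_{(i-1)\Delta_n}\bigr)^2},$$ and $$V_{00}=\sum_{k\in\mathbb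 Z}2\gamma(k\Delta_n)^2,\quad V_{01}=\sum_{k\in\mathbb Z}2\gamma(k\Delta_n)\gamma((k-1)\Delta_n),\quad V_{11}=\sum_{k\in\mathbb Z}\bigl[\gamma(k\Delta_n)^2+\gamma((k+1)\Delta_n)\gamma((k-1)\Delta_n)\bigr],$$ $$v=4V_{00}-8V_{01}+4V_{11}.$$ Then $\tau_n>0$, the three series converge absolutely, $v\ge 0$, and, as $N\to\infty$, $$\sqrt N\,(\tau_n^N-\tau_n)\xrightarrow{d}N\!\left(0,\frac{v}{4\tau_n^2}\right).$$ As a consequence, $\tau_n^N\to\tau_n$ in probability as $N\to\infty$. -/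

import Mathlib

open MeasureTheory ProbabilityTheory Filter Topology
open scoped NNReal ENNReal

namespace BSS

noncomputable section

/-- A two-sided standard Brownian motion: `W t = W¹ t` for `t ≥ 0` and `W t = W² (-t)` for `t ≤ 0`,
where `W¹` and `W²` are independent standard Brownian motions on `[0, ∞)` (with almost surely
continuous paths). -/
structure IsTwoSidedBrownian {Ω : Type*} [MeasurableSpace Ω] (W : ℝ → Ω → ℝ) (P : Measure Ω) :
    Prop where
  pos : IsBrownianReal (fun t : ℝ≥0 => W (t : ℝ)) P
  neg : IsBrownianReal (fun t : ℝ≥0 => W (-(t : ℝ))) P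
  indep : IndepFun (fun ω (t : ℝ≥0) => W (t : ℝ) ω) (fun ω (t : ℝ≥0) => W (-(t : ℝ)) ω) P

/-- A deterministic step function `∑ i, c i • 𝟙_(a i, b i]` on the real line
(the intervals may overlap). -/
structure StepFun where
  n : ℕ
  c : Fin n → ℝ
  a : Fin n → ℝ
  b : Fin n → ℝ
  a_le_b : ∀ i, a i ≤ b i

/-- The step function as a function. -/
def StepFun.toFun (φ : StepFun) (s : ℝ) : ℝ :=
  ∑ i, (Set.Ioc (φ.a i) (φ.b i)).indicator (fun _ => φ.c i) s

/-- The integral `∑ i, c i (W (b i) - W (a i))` of a step function against `W`. -/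
def StepFun.integral {Ω : Type*} (φ : StepFun) (W : ℝ → Ω → ℝ) (ω : Ω) : ℝ :=
  ∑ i, φ.c i * (W (φ.b i) ω - W (φ.a i) ω)

/-- `I` is (a version of) the Wiener integral `∫ f(s) dW_s` over the real line of `f ∈ L²(ℝ)`: it is
the `L²(P)`-limit of the integrals of step functions which converge to `f` in `L²(ℝ)`. -/
def IsWienerIntegral {Ω : Type*} [MeasurableSpace Ω] (W : ℝ → Ω → ℝ) (P : Measure Ω)
    (f : ℝ → ℝ) (I : Ω → ℝ) : Prop :=
  MemLp I 2 P ∧ ∃ φ : ℕ → StepFun,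
    Tendsto (fun m => eLpNorm (fun s => (φ m).toFun s - f s) 2 volume) atTop (𝓝 0) ∧
    Tendsto (fun m => eLpNorm (fun ω => (φ m).integral W ω - I ω) 2 P) atTop (𝓝 0)

/-- `X` is the Gaussian core with kernel `g` and driving Brownian motion `W`:
`X_t = ∫_{-∞}^t g(t - s) dW_s` for every real `t`. -/
def IsGaussianCore {Ω : Type*} [MeasurableSpace Ω] (g : ℝ → ℝ) (W : ℝ → Ω → ℝ) (P : Measure Ω)
    (X : ℝ → Ω → ℝ) : Prop :=
  ∀ t : ℝ, IsWienerIntegral W P ((Set.Iic t).indicator fun s => g (t - s)) (X t)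

/-- The autocovariance function of the Gaussian core, `γ(h) = ∫_0^∞ g(x) g(x + h) dx` for `h ≥ 0`,
extended to negative lags as an even function. -/
def autocov (g : ℝ → ℝ) (h : ℝ) : ℝ := ∫ x in Set.Ioi (0 : ℝ), g x * g (x + |h|)

/-- The second-order structure function `R(t) = E[(X_t - X_0)²]`. -/
def structureFn {Ω : Type*} [MeasurableSpace Ω] (P : Measure Ω) (X : ℝ → Ω → ℝ) (t : ℝ) : ℝ :=
  ∫ ω, (X t ω - X 0 ω) ^ 2 ∂P

/-- The scale factor `τ = √R(Δ)`. -/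
def scaleFactor {Ω : Type*} [MeasurableSpace Ω] (P : Measure Ω) (X : ℝ → Ω → ℝ) (Δ : ℝ) : ℝ :=
  √(structureFn P X Δ)

/-- The estimator `τ^N = √((1/N) ∑_{i=1}^N (X_{iΔ} - X_{(i-1)Δ})²)`. -/
def scaleEstimator {Ω : Type*} (X : ℝ → Ω → ℝ) (Δ : ℝ) (N : ℕ) (ω : Ω) : ℝ :=
  √((1 / (N : ℝ)) * ∑ i ∈ Finset.Icc 1 N, (X ((i : ℝ) * Δ) ω - X (((i : ℝ) - 1) * Δ) ω) ^ 2)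

/-- The summand of `V_00`. -/
def term00 (g : ℝ → ℝ) (Δ : ℝ) (k : ℤ) : ℝ := 2 * autocov g (k * Δ) ^ 2

/-- The summand of `V_01`. -/
def term01 (g : ℝ → ℝ) (Δ : ℝ) (k : ℤ) : ℝ :=
  2 * autocov g (k * Δ) * autocov g (((k : ℝ) - 1) * Δ)

/-- The summand of `V_11`. -/
def term11 (g : ℝ → ℝ) (Δ : ℝ) (k : ℤ) : ℝ :=
  autocov g (k * Δ) ^ 2 + autocov g (((k : ℝ) + 1) * Δ) * autocov g (((k : ℝ) - 1) * Δ)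

/-- `v = 4 V_00 - 8 V_01 + 4 V_11`, with `V_pq` the sums over all integers of the terms above. -/
def asympVar (g : ℝ → ℝ) (Δ : ℝ) : ℝ :=
  4 * (∑' k : ℤ, term00 g Δ k) - 8 * (∑' k : ℤ, term01 g Δ k) + 4 * (∑' k : ℤ, term11 g Δ k)

end

end BSS

/-! ### The centred chi-square law and its characteristic function -/

namespace BSS

/-! The increments of `X` over the grid form a centred stationary Gaussian sequence. By the Itô
isometry their covariance at lag `k` is the negative second difference `r k = 2 a k - a (k-1) - a
(k+1)` of `a k = γ(kΔ)`. Since `g ≥ 0`, the hypothesis says exactly that `a`, hence `r`, is square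
summable. Expanding the square gives `v = 2 ∑ r k ^ 2`, so `v ≥ 0`, and `τ² = r 0`. This is positive
because a kernel supported on the positive half-line and invariant under a translation vanishes.

The core is a central limit theorem for `∑ (Z i ^ 2 - r 0)`, proved by diagonalisation
(`charFun_sum_sq_of_hasGaussianLaw`). In an orthonormal eigenbasis of the Toeplitz covariance matrix
the sum becomes `∑ λ_j (ξ_j ^ 2 - 1)` with independent standard Gaussian `ξ_j`. After division by
`√N` two facts suffice: the largest weight tends to zero (Gershgorin, with Cauchy–Schwarz on the row
sums), and the squared weights sum to `N⁻¹ ∑ r (i-j) ^ 2`, which tends to `∑ r k ^ 2` by Cesàro.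
Each factor of the characteristic function is then close to `exp (-s ^ 2)`, as in Lindeberg's
argument (`tendsto_prod_charFun_centredChiSq`).

The delta method for the square root (`tendstoInDistribution_sqrt`) turns this into the limit for
the estimator and gives consistency. -/

lemma integrable_pow_gaussianReal (m : ℝ) (v : ℝ≥0) (n : ℕ) :
    Integrable (fun x : ℝ => x ^ n) (gaussianReal m v) := by
  have h : MemLp id (n : ℝ≥0∞) (gaussianReal m v) := memLp_id_gaussianReal' _ (by simp)
  rcases Nat.eq_zero_or_pos n with rfl | hn
  · simp
  have := h.integrable_norm_pow hn.ne'
  refine (integrable_norm_iff (by fun_prop)).1 ?_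
  simpa [norm_pow] using this

lemma integral_sq_gaussianReal_zero_one : ∫ x, x ^ 2 ∂gaussianReal 0 1 = 1 := by
  have := variance_fun_id_gaussianReal (μ := 0) (v := 1)
  rw [variance_eq_integral (by fun_prop)] at this
  simpa using this

/-- Gaussian integration by parts: the derivative of `x ^ 3` times the density is `3 x ^ 2 - x ^ 4`
times the density, and it integrates to zero. -/
lemma integral_pow_four_gaussianReal_zero_one : ∫ x, x ^ 4 ∂gaussianReal 0 1 = 3 := by
  have hpdf : ∀ x, HasDerivAt (gaussianPDFReal 0 1) (-x * gaussianPDFReal 0 1 x) x := by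
    intro x
    have h1 : HasDerivAt (fun y : ℝ => -(y - 0) ^ 2 / (2 * ((1 : ℝ≥0) : ℝ))) (-x) x := by
      have := (((hasDerivAt_id x).sub_const 0).pow 2).neg.div_const (2 * ((1 : ℝ≥0) : ℝ))
      refine this.congr_deriv ?_
      simp only [id_eq, sub_zero, NNReal.coe_one]
      norm_num
      ring
    have h2 := h1.exp.const_mul (√(2 * Real.pi * ((1 : ℝ≥0) : ℝ)))⁻¹
    rw [gaussianPDFReal_def]
    exact h2.congr_deriv (by ring)
  have hint : ∀ n : ℕ, Integrable (fun x : ℝ => gaussianPDFReal 0 1 x * x ^ n) := by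
    intro n
    have := integrable_pow_gaussianReal 0 1 n
    rw [gaussianReal_of_var_ne_zero _ one_ne_zero, integrable_withDensity_iff_integrable_smul'
      (by fun_prop) (ae_of_all _ fun _ => gaussianPDF_lt_top)] at this
    simpa [toReal_gaussianPDF] using this
  have hval : ∀ n : ℕ, ∫ x, x ^ n ∂gaussianReal 0 1 = ∫ x, gaussianPDFReal 0 1 x * x ^ n := by
    intro n
    rw [integral_gaussianReal_eq_integral_smul one_ne_zero]
    rfl
  have hder : ∀ x, HasDerivAt (fun x : ℝ => gaussianPDFReal 0 1 x * x ^ 3)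
      (3 * (gaussianPDFReal 0 1 x * x ^ 2) - gaussianPDFReal 0 1 x * x ^ 4) x := by
    intro x
    refine ((hpdf x).mul (hasDerivAt_pow 3 x)).congr_deriv ?_
    norm_num
    ring
  have hz := integral_eq_zero_of_hasDerivAt_of_integrable hder
    (((hint 2).const_mul 3).sub (hint 4)) (hint 3)
  rw [integral_sub ((hint 2).const_mul 3) (hint 4), integral_const_mul, ← hval 2, ← hval 4,
    integral_sq_gaussianReal_zero_one] at hz
  linarith

/-- The law of `ξ ^ 2 - 1` for a standard Gaussian variable `ξ`. -/
noncomputable def centredChiSq : Measure ℝ := (gaussianReal 0 1).map fun x => x ^ 2 - 1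

instance : IsProbabilityMeasure centredChiSq :=
  Measure.isProbabilityMeasure_map (by fun_prop)

/-- The law has mean 0 and variance `3 - 1 = 2`, so its characteristic function and `exp (-s ^ 2)`
are both `1 - s ^ 2 + o(s ^ 2)`. -/
lemma charFun_centredChiSq_approx {ε : ℝ} (hε : 0 < ε) :
    ∃ δ > 0, ∀ s : ℝ, |s| < δ →
      ‖charFun centredChiSq s - Complex.exp (-(s : ℂ) ^ 2)‖ ≤ ε * s ^ 2 := by
  have i2 := integrable_pow_gaussianReal 0 1 2
  have i4 := integrable_pow_gaussianReal 0 1 4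
  -- The factor `(√2)⁻¹` gives the unit variance that the Taylor expansion requires; substituting
  -- `√2 * s` below undoes it.
  have hT := taylor_charFun_two (P := gaussianReal 0 1) (X := fun x : ℝ => (√2)⁻¹ * (x ^ 2 - 1))
    (by fun_prop)
    (by
      rw [integral_const_mul, integral_sub i2 (by fun_prop), integral_sq_gaussianReal_zero_one]
      simp)
    (by
      have : ((fun x : ℝ => (√2)⁻¹ * (x ^ 2 - 1)) ^ 2)
          = fun x => 2⁻¹ * (x ^ 4 - 2 * x ^ 2 + 1) := by
        ext x
        simp only [Pi.pow_apply, mul_pow, inv_pow, Real.sq_sqrt zero_le_two]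
        ring
      have h4 : Integrable (fun x : ℝ => x ^ 4 - 2 * x ^ 2) (gaussianReal 0 1) :=
        i4.sub (i2.const_mul 2)
      rw [this, integral_const_mul, integral_add h4 (by fun_prop),
        integral_sub i4 (i2.const_mul 2), integral_const_mul,
        integral_pow_four_gaussianReal_zero_one, integral_sq_gaussianReal_zero_one]
      norm_num)
  have hlim : Tendsto (fun s : ℝ => √2 * s) (𝓝 0) (𝓝 0) := by
    have : Continuous fun s : ℝ => √2 * s := by fun_prop
    simpa using this.tendsto 0
  have h1 := hT.comp_tendsto hlim
  have hE : (fun s : ℝ => (1 - (s : ℂ) ^ 2) - Complex.exp (-(s : ℂ) ^ 2)) =o[𝓝 0]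
      fun s => s ^ 2 := by
    have := (hasDerivAt_iff_isLittleO_nhds_zero.1 (Complex.hasDerivAt_exp 0))
    have hl : Tendsto (fun s : ℝ => -(s : ℂ) ^ 2) (𝓝 0) (𝓝 0) := by
      have : Continuous fun s : ℝ => -(s : ℂ) ^ 2 := by fun_prop
      simpa using this.tendsto 0
    have h := (this.comp_tendsto hl).neg_left.norm_right
    refine (h.congr (fun s => ?_) (fun s => ?_))
    · simp
      ring
    · simp
  have hsum : (fun s : ℝ => charFun centredChiSq s - Complex.exp (-(s : ℂ) ^ 2)) =o[𝓝 0]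
      fun s => s ^ 2 := by
    have h2 : (fun s : ℝ => charFun centredChiSq s - (1 - (s : ℂ) ^ 2)) =o[𝓝 0]
        fun s => s ^ 2 := by
      have h3 : (fun s : ℝ => (√2 * s) ^ 2) =O[𝓝 0] fun s => s ^ 2 := by
        simp_rw [mul_pow]
        exact Asymptotics.isBigO_const_mul_self _ _ _
      refine (h1.trans_isBigO h3).congr_left fun s => ?_
      simp only [Function.comp_apply]
      rw [charFun_map_mul_comp (by fun_prop)]
      rw [← mul_assoc, inv_mul_cancel₀ (by positivity), one_mul, centredChiSq]
      congr 2
      push_cast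
      rw [mul_pow, ← Complex.ofReal_pow, Real.sq_sqrt zero_le_two]
      push_cast
      ring
    simpa using h2.add hE
  obtain ⟨δ, hδ, h⟩ := Metric.eventually_nhds_iff.1 (hsum.def hε)
  refine ⟨δ, hδ, fun s hs => ?_⟩
  have := h (y := s) (by simpa using hs)
  simpa using this

/-- Replaces the factors one at a time; the others have norm at most 1, so the errors only add. -/
lemma norm_prod_sub_prod_le {ι : Type*} (s : Finset ι) (a b : ι → ℂ) (ha : ∀ i, ‖a i‖ ≤ 1)
    (hb : ∀ i, ‖b i‖ ≤ 1) : ‖∏ i ∈ s, a i - ∏ i ∈ s, b i‖ ≤ ∑ i ∈ s, ‖a i - b i‖ := by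
  classical
  induction s using Finset.induction_on with
  | empty => simp
  | insert i s his ih =>
    rw [Finset.prod_insert his, Finset.prod_insert his, Finset.sum_insert his]
    have hB : ‖∏ i ∈ s, b i‖ ≤ 1 := by
      rw [norm_prod]
      exact Finset.prod_le_one (fun _ _ => norm_nonneg _) fun i _ => hb i
    calc ‖a i * ∏ i ∈ s, a i - b i * ∏ i ∈ s, b i‖
        = ‖(a i - b i) * ∏ i ∈ s, b i + a i * (∏ i ∈ s, a i - ∏ i ∈ s, b i)‖ := by
          congr 1; ring
      _ ≤ ‖a i - b i‖ * ‖∏ i ∈ s, b i‖ + ‖a i‖ * ‖∏ i ∈ s, a i - ∏ i ∈ s, b i‖ := by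
          rw [← norm_mul, ← norm_mul]
          exact norm_add_le _ _
      _ ≤ ‖a i - b i‖ * 1 + 1 * ∑ i ∈ s, ‖a i - b i‖ := by
          gcongr
          exact ha i
      _ = _ := by ring

variable {Ω : Type*} [MeasurableSpace Ω] {P : Measure Ω}

/-- The characteristic function of a centred sum of squares of independent centred Gaussian
variables. -/
lemma charFun_sum_sq_of_iIndepFun {ι : Type*} [Fintype ι] {Y : ι → Ω → ℝ} {l : ι → ℝ}
    (hl : ∀ j, 0 ≤ l j) (hY : ∀ j, HasLaw (Y j) (gaussianReal 0 (l j).toNNReal) P)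
    (hind : iIndepFun Y P) (t : ℝ) :
    charFun (P.map fun ω => ∑ j, (Y j ω ^ 2 - l j)) t = ∏ j, charFun centredChiSq (l j * t) := by
  have hm : ∀ j, AEMeasurable (Y j) P := fun j => (hY j).aemeasurable
  have hind' : iIndepFun (fun j ω => Y j ω ^ 2 - l j) P :=
    hind.comp (fun j x => x ^ 2 - l j) (by fun_prop)
  rw [hind'.charFun_map_fun_sum_eq_prod (by fun_prop), Finset.prod_apply]
  refine Finset.prod_congr rfl fun j _ => ?_
  have h1 : P.map (fun ω => Y j ω ^ 2 - l j)
      = centredChiSq.map (fun x => l j * x) := by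
    have e1 : P.map (fun ω => Y j ω ^ 2 - l j) = (P.map (Y j)).map (fun x => x ^ 2 - l j) := by
      rw [AEMeasurable.map_map_of_aemeasurable (by fun_prop) (hm j)]
      rfl
    have e2 : gaussianReal 0 (l j).toNNReal = (gaussianReal 0 1).map (fun x => √(l j) * x) := by
      rw [gaussianReal_map_const_mul]
      congr 1
      · simp
      · ext
        simp [Real.sq_sqrt (hl j), hl j]
    rw [e1, (hY j).map_eq, e2, centredChiSq, Measure.map_map (by fun_prop) (by fun_prop),
      Measure.map_map (by fun_prop) (by fun_prop)]
    congr 1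
    ext x
    simp only [Function.comp_apply, mul_pow, Real.sq_sqrt (hl j)]
    ring
  rw [h1, charFun_map_mul]

end BSS

/-! ### Diagonalising the covariance matrix -/

namespace BSS

variable {Ω : Type*} [MeasurableSpace Ω] {P : Measure Ω}

/-- Gershgorin: some row `k` has its diagonal entry within the off-diagonal absolute row sum of the
eigenvalue. -/
lemma eigenvalues_le_of_sum_abs_le {ι : Type*} [Fintype ι] [DecidableEq ι] {S : Matrix ι ι ℝ}
    (hS : S.IsHermitian) {B : ℝ} (hB : ∀ k, ∑ j, |S k j| ≤ B) (j : ι) : hS.eigenvalues j ≤ B := by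
  have hev : Module.End.HasEigenvalue (Matrix.toLin' S) (hS.eigenvalues j) := by
    refine Module.End.hasEigenvalue_of_hasEigenvector (x := ⇑(hS.eigenvectorBasis j)) ?_
    refine Module.End.hasEigenvector_iff.2 ⟨?_, ?_⟩
    · rw [Module.End.mem_eigenspace_iff, Matrix.toLin'_apply]
      exact hS.mulVec_eigenvectorBasis j
    · intro h
      have h0 : hS.eigenvectorBasis j = 0 := by
        ext i
        exact congrFun h i
      have := hS.eigenvectorBasis.orthonormal.1 j
      simp [h0] at this
  obtain ⟨k, hk⟩ := eigenvalue_mem_ball hev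
  rw [Metric.mem_closedBall, Real.dist_eq] at hk
  have h1 := hB k
  rw [← Finset.add_sum_erase _ _ (Finset.mem_univ k)] at h1
  have h2 := le_abs_self (hS.eigenvalues j - S k k)
  have h3 := le_abs_self (S k k)
  simp only [Real.norm_eq_abs] at hk
  linarith

/-- Both sides are the trace of `S * S`, by conjugation invariance and by symmetry respectively. -/
lemma sum_eigenvalues_sq {ι : Type*} [Fintype ι] [DecidableEq ι] {S : Matrix ι ι ℝ}
    (hS : S.IsHermitian) : ∑ j, hS.eigenvalues j ^ 2 = ∑ i, ∑ j, S i j ^ 2 := by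
  have hD := hS.conjStarAlgAut_star_eigenvectorUnitary
  rw [Unitary.conjStarAlgAut_star_apply] at hD
  set U : Matrix ι ι ℝ := (hS.eigenvectorUnitary : Matrix ι ι ℝ) with hU
  have hUU : U * star U = 1 := Unitary.coe_mul_star_self hS.eigenvectorUnitary
  have h1 : (star U * S * U) * (star U * S * U) = star U * (S * S) * U := by
    calc (star U * S * U) * (star U * S * U) = star U * S * (U * star U) * S * U := by
          simp only [Matrix.mul_assoc]
      _ = _ := by rw [hUU]; simp only [Matrix.mul_assoc, Matrix.one_mul]
  have h2 : Matrix.trace (star U * (S * S) * U) = Matrix.trace (S * S) := by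
    rw [Matrix.mul_assoc, Matrix.trace_mul_comm, Matrix.mul_assoc, hUU, Matrix.mul_one]
  rw [← h1, hD, Matrix.diagonal_mul_diagonal, Matrix.trace_diagonal] at h2
  simp only [Function.comp_apply, RCLike.ofReal_real_eq_id, id_eq] at h2
  simp_rw [sq]
  rw [h2]
  simp only [Matrix.trace, Matrix.diag, Matrix.mul_apply]
  refine Finset.sum_congr rfl fun i _ => Finset.sum_congr rfl fun j _ => ?_
  rw [← hS.apply i j]
  simp

/-- A centred Gaussian vector with covariance matrix `S` has a sum of squares distributed as a
weighted sum of independent squares, with the eigenvalues of `S` as weights. -/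
lemma charFun_sum_sq_of_hasGaussianLaw {ι : Type*} [Fintype ι] [DecidableEq ι] {Z : ι → Ω → ℝ}
    (hZ : HasGaussianLaw (fun ω i => Z i ω) P) (h0 : ∀ i, ∫ ω, Z i ω ∂P = 0)
    {S : Matrix ι ι ℝ} (hS : S.IsHermitian) (hcov : ∀ i j, cov[Z i, Z j; P] = S i j) :
    (∀ j, 0 ≤ hS.eigenvalues j) ∧ ∀ t, charFun (P.map fun ω => ∑ i, (Z i ω ^ 2 - S i i)) t
      = ∏ j, charFun centredChiSq (hS.eigenvalues j * t) := by
  have hP := hZ.isProbabilityMeasure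
  have hZL : ∀ i, MemLp (Z i) 2 P := fun i => (hZ.eval i).memLp_two
  have hD := hS.conjStarAlgAut_star_eigenvectorUnitary
  rw [Unitary.conjStarAlgAut_star_apply] at hD
  have htr : S.trace = ∑ j, hS.eigenvalues j := by
    simpa using hS.trace_eq_sum_eigenvalues
  set U : Matrix ι ι ℝ := (hS.eigenvectorUnitary : Matrix ι ι ℝ) with hU
  set l := hS.eigenvalues with hl
  have hUU : U * star U = 1 := Unitary.coe_mul_star_self hS.eigenvectorUnitary
  let Y : ι → Ω → ℝ := fun j ω => ∑ i, U i j * Z i ω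
  have hYG : HasGaussianLaw (fun ω j => Y j ω) P := by
    let L : (ι → ℝ) →L[ℝ] (ι → ℝ) :=
      ContinuousLinearMap.pi fun j => ∑ i, U i j • ContinuousLinearMap.proj i
    have := hZ.map_fun L
    convert! this using 2 with ω
    ext j
    simp [L, Y]
  have hYcov : ∀ j k, cov[Y j, Y k; P] = if j = k then l j else 0 := by
    intro j k
    have h1 : cov[Y j, Y k; P] = (star U * S * U) j k := by
      have e : ∀ j, Y j = fun ω => ∑ i, (U i j * Z i ω) := fun _ => rfl
      rw [e, e, covariance_fun_sum_fun_sum (fun i => (hZL i).const_mul _)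
        (fun i => (hZL i).const_mul _)]
      simp only [covariance_const_mul_left, covariance_const_mul_right, hcov, Matrix.mul_apply,
        Finset.sum_mul, Matrix.star_apply, star_trivial]
      rw [Finset.sum_comm]
      refine Finset.sum_congr rfl fun _ _ => Finset.sum_congr rfl fun _ _ => by ring
    rw [h1, hD, Matrix.diagonal_apply]
    simp
  -- Jointly Gaussian and uncorrelated, hence independent.
  have hind : iIndepFun Y P := hYG.iIndepFun_of_covariance_eq_zero fun i j hij => by
    rw [hYcov, if_neg hij]
  have hYvar : ∀ j, Var[Y j; P] = l j := fun j => by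
    rw [← covariance_self (hYG.eval j).aemeasurable, hYcov, if_pos rfl]
  have hl0 : ∀ j, 0 ≤ l j := fun j => hYvar j ▸ variance_nonneg _ _
  have hY0 : ∀ j, ∫ ω, Y j ω ∂P = 0 := fun j => by
    simp only [Y]
    rw [integral_finsetSum _ fun i _ => ((hZL i).integrable (by norm_num)).const_mul _]
    simp [integral_const_mul, h0]
  refine ⟨hl0, fun t => ?_⟩
  have hlaw : ∀ j, HasLaw (Y j) (gaussianReal 0 (l j).toNNReal) P := fun j =>
    ⟨(hYG.eval j).aemeasurable, by rw [(hYG.eval j).map_eq_gaussianReal, hY0, hYvar]⟩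
  rw [← charFun_sum_sq_of_iIndepFun hl0 hlaw hind]
  congr 2
  ext ω
  -- The centring terms agree because the trace is the sum of the eigenvalues; the squares agree
  -- because `U` is orthogonal.
  rw [Finset.sum_sub_distrib, Finset.sum_sub_distrib, ← htr, Matrix.trace]
  congr 1
  have h2 : (fun j => Y j ω) = Matrix.mulVec (star U) (fun i => Z i ω) := by
    ext j
    simp [Y, Matrix.mulVec, dotProduct]
  have h3 : (∑ j, Y j ω ^ 2) = (fun j => Y j ω) ⬝ᵥ (fun j => Y j ω) := by
    simp [dotProduct, sq]
  rw [h3, h2, Matrix.dotProduct_mulVec, Matrix.vecMul_mulVec]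
  have h4 : (star U).transpose = U := by ext; simp
  rw [h4, hUU]
  simp [dotProduct, sq]

end BSS

/-! ### Sums over Toeplitz arrays -/

namespace BSS

lemma tendsto_sum_Icc_int {f : ℤ → ℝ} (hf : Summable f) :
    Tendsto (fun N : ℕ => ∑ k ∈ Finset.Icc (-(N : ℤ)) N, f k) atTop (𝓝 (∑' k, f k)) := by
  refine hf.hasSum.comp (Filter.tendsto_atTop_finset_of_monotone ?_ fun k => ⟨k.natAbs, ?_⟩)
  · intro a b hab
    refine Finset.Icc_subset_Icc ?_ ?_ <;> simpa using hab
  · simp only [Finset.mem_Icc]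
    omega

/-- Enlarging the square from `N` to `N + 1` adds a border on which each lag from `-N` to `N` occurs
exactly once. In this form the normalised double sum is a Cesàro mean. -/
lemma sum_range_sub_eq (f : ℤ → ℝ) (N : ℕ) :
    ∑ i ∈ Finset.range N, ∑ j ∈ Finset.range N, f ((i : ℤ) - j)
      = ∑ n ∈ Finset.range N, ∑ k ∈ Finset.Icc (-(n : ℤ)) n, f k := by
  have hI : ∀ n : ℕ, ∑ k ∈ Finset.Icc (-(n : ℤ)) n, f k
      = f 0 + ∑ i ∈ Finset.range n, (f (i + 1) + f (-(i + 1))) := by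
    intro n
    induction n with
    | zero => simp
    | succ n ih =>
      rw [Finset.sum_range_succ, ← add_assoc, ← ih]
      have : Finset.Icc (-((n + 1 : ℕ) : ℤ)) ((n + 1 : ℕ) : ℤ)
          = insert ((n : ℤ) + 1) (insert (-((n : ℤ) + 1)) (Finset.Icc (-(n : ℤ)) n)) := by
        ext k
        simp only [Finset.mem_Icc, Finset.mem_insert]
        push_cast
        omega
      rw [this, Finset.sum_insert, Finset.sum_insert]
      · ring
      · simp
      · simp only [Finset.mem_insert, Finset.mem_Icc]
        omega
  induction N with
  | zero => simp
  | succ N ih =>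
    rw [Finset.sum_range_succ (fun n : ℕ => ∑ k ∈ Finset.Icc (-(n : ℤ)) n, f k), ← ih, hI]
    rw [Finset.sum_range_succ]
    simp_rw [Finset.sum_range_succ _ N]
    rw [Finset.sum_add_distrib, Finset.sum_add_distrib]
    have r1 : ∑ i ∈ Finset.range N, f ((i : ℤ) - N) = ∑ i ∈ Finset.range N, f (-((i : ℤ) + 1)) := by
      rw [← Finset.sum_range_reflect]
      refine Finset.sum_congr rfl fun i hi => ?_
      have := Finset.mem_range.1 hi
      congr 1
      omega
    have r2 : ∑ i ∈ Finset.range N, f ((N : ℤ) - i) = ∑ i ∈ Finset.range N, f ((i : ℤ) + 1) := by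
      rw [← Finset.sum_range_reflect]
      refine Finset.sum_congr rfl fun i hi => ?_
      have := Finset.mem_range.1 hi
      congr 1
      omega
    rw [r1, r2, sub_self]
    ring

/-- Cesàro convergence of the normalised double sums of a summable Toeplitz array. -/
lemma tendsto_toeplitz_sum {f : ℤ → ℝ} (hf : Summable f) :
    Tendsto (fun N : ℕ => (N : ℝ)⁻¹ *
      ∑ i ∈ Finset.range N, ∑ j ∈ Finset.range N, f ((i : ℤ) - j)) atTop (𝓝 (∑' k, f k)) := by
  simp_rw [sum_range_sub_eq]
  exact (tendsto_sum_Icc_int hf).cesaro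

/-- Outside a finite set `s` the squares have a small sum, and Cauchy–Schwarz over at most `2N + 1`
lags costs only a factor of order `√N`. The fixed contribution of `s` is killed by `(√N)⁻¹`. -/
lemma tendsto_sum_abs_div_sqrt {r : ℤ → ℝ} (hr : Summable fun k => r k ^ 2) :
    Tendsto (fun N : ℕ => (√N)⁻¹ * ∑ k ∈ Finset.Icc (-(N : ℤ)) N, |r k|) atTop (𝓝 0) := by
  rw [Metric.tendsto_atTop]
  intro ε hε
  obtain ⟨s, hs⟩ := summable_iff_vanishing_norm.1 hr ((ε / 4) ^ 2) (by positivity)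
  have hlim : Tendsto (fun N : ℕ => (√(N : ℝ))⁻¹ * ∑ k ∈ s, |r k|) atTop (𝓝 0) := by
    rw [← zero_mul (∑ k ∈ s, |r k|)]
    exact (tendsto_inv_atTop_zero.comp (Real.tendsto_sqrt_atTop.comp
      tendsto_natCast_atTop_atTop)).mul_const _
  obtain ⟨N₀, hN₀⟩ := eventually_atTop.1 (hlim.eventually_lt_const (half_pos hε))
  refine ⟨max N₀ 1, fun N hN => ?_⟩
  have hN1 : 1 ≤ N := (le_max_right _ _).trans hN
  have hNpos : (1 : ℝ) ≤ N := by exact_mod_cast hN1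
  have hsq : 0 < √(N : ℝ) := Real.sqrt_pos.2 (by linarith)
  have h1 := hN₀ N ((le_max_left _ _).trans hN)
  set I := Finset.Icc (-(N : ℤ)) N with hI
  have hsplit : ∑ k ∈ I, |r k| ≤ ∑ k ∈ s, |r k| + ∑ k ∈ I \ s, |r k| := by
    rw [← Finset.sum_inter_add_sum_sdiff I s]
    gcongr
    exact Finset.inter_subset_right
  have hcs : (∑ k ∈ I \ s, |r k|) ^ 2 ≤ (√N * (ε / 2)) ^ 2 := by
    have hv := hs (I \ s) Finset.sdiff_disjoint
    rw [Real.norm_of_nonneg (Finset.sum_nonneg fun _ _ => sq_nonneg _)] at hv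
    have hcard : ((I \ s).card : ℝ) ≤ 3 * N := by
      have h := Finset.card_le_card (Finset.sdiff_subset : I \ s ⊆ I)
      have h' : I.card = 2 * N + 1 := by
        rw [hI, Int.card_Icc]; omega
      have : (I \ s).card ≤ 3 * N := by omega
      exact_mod_cast this
    calc (∑ k ∈ I \ s, |r k|) ^ 2 ≤ (I \ s).card * ∑ k ∈ I \ s, |r k| ^ 2 :=
          sq_sum_le_card_mul_sum_sq
      -- For `N ≥ 1`, `2N + 1 ≤ 3N`; the choice `ε / 4` works since `3 / 16 ≤ 1 / 4`.
      _ ≤ (3 * N) * (ε / 4) ^ 2 := by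
          simp only [sq_abs]
          gcongr
      _ ≤ (√N * (ε / 2)) ^ 2 := by
          rw [mul_pow, Real.sq_sqrt (by positivity)]
          nlinarith [sq_nonneg ε]
  have h2 := abs_le_of_sq_le_sq hcs (by positivity)
  have h3 : (√(N : ℝ))⁻¹ * ∑ k ∈ I \ s, |r k| ≤ ε / 2 := by
    rw [inv_mul_le_iff₀ hsq]
    exact (le_abs_self _).trans h2
  rw [Real.dist_eq, sub_zero, abs_of_nonneg (by positivity)]
  calc (√(N : ℝ))⁻¹ * ∑ k ∈ I, |r k|
      ≤ (√(N : ℝ))⁻¹ * (∑ k ∈ s, |r k| + ∑ k ∈ I \ s, |r k|) := by gcongr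
    _ < ε := by rw [mul_add]; linarith

lemma sum_range_abs_sub_le (r : ℤ → ℝ) {N k : ℕ} (hk : k < N) :
    ∑ j ∈ Finset.range N, |r ((k : ℤ) - j)| ≤ ∑ i ∈ Finset.Icc (-(N : ℤ)) N, |r i| := by
  have hinj : Set.InjOn (fun j : ℕ => (k : ℤ) - j) (Finset.range N) := by
    intro a _ b _ h
    simp only at h
    omega
  rw [← Finset.sum_image (f := fun i => |r i|) hinj]
  refine Finset.sum_le_sum_of_subset_of_nonneg ?_ fun _ _ _ => abs_nonneg _
  intro i hi
  obtain ⟨j, hj, rfl⟩ := Finset.mem_image.1 hi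
  have := Finset.mem_range.1 hj
  simp only [Finset.mem_Icc]
  omega

/-! ### Central limit theorem for squares of a Gaussian sequence -/

variable {Ω : Type*} [MeasurableSpace Ω] {P : Measure Ω}

/-- Products of characteristic functions of small weighted centred squares are asymptotically
Gaussian. -/
lemma tendsto_prod_charFun_centredChiSq {ι : ℕ → Type*} [∀ N, Fintype (ι N)]
    {l : ∀ N, ι N → ℝ} {B : ℕ → ℝ} {σ : ℝ} (hl0 : ∀ N j, 0 ≤ l N j) (hlB : ∀ N j, l N j ≤ B N)
    (hB : Tendsto B atTop (𝓝 0)) (hσ : Tendsto (fun N => ∑ j, l N j ^ 2) atTop (𝓝 σ)) (t : ℝ) :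
    Tendsto (fun N => ∏ j, charFun centredChiSq (l N j * t)) atTop
      (𝓝 (Complex.exp (-(t : ℂ) ^ 2 * σ))) := by
  have hexp : Tendsto (fun N => ∏ j, Complex.exp (-((l N j * t : ℝ) : ℂ) ^ 2)) atTop
      (𝓝 (Complex.exp (-(t : ℂ) ^ 2 * σ))) := by
    have h1 : ∀ N, ∏ j, Complex.exp (-((l N j * t : ℝ) : ℂ) ^ 2)
        = Complex.exp (-(t : ℂ) ^ 2 * ((∑ j, l N j ^ 2 : ℝ) : ℂ)) := by
      intro N
      rw [← Complex.exp_sum]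
      congr 1
      push_cast
      rw [Finset.mul_sum]
      refine Finset.sum_congr rfl fun j _ => by ring
    simp_rw [h1]
    have hc : Continuous fun x : ℝ => Complex.exp (-(t : ℂ) ^ 2 * (x : ℂ)) := by fun_prop
    exact (hc.tendsto σ).comp hσ
  suffices h : Tendsto (fun N => ∏ j, charFun centredChiSq (l N j * t)
      - ∏ j, Complex.exp (-((l N j * t : ℝ) : ℂ) ^ 2)) atTop (𝓝 0) by
    simpa using h.add hexp
  rw [Metric.tendsto_atTop]
  intro ε hε
  -- Eventually the squared weights sum to less than `|σ| + 1`; the final `+ 1` keeps the divisor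
  -- positive at `t = 0` and the last inequality strict.
  have hC : 0 < t ^ 2 * (|σ| + 1) + 1 := by positivity
  obtain ⟨δ, hδ, happ⟩ := charFun_centredChiSq_approx (div_pos hε hC)
  have hBt : Tendsto (fun N => B N * |t|) atTop (𝓝 0) := by simpa using hB.mul_const |t|
  obtain ⟨N₀, hN₀⟩ := eventually_atTop.1 ((hBt.eventually_lt_const hδ).and
    (hσ.eventually_lt_const ((le_abs_self σ).trans_lt (lt_add_one |σ|))))
  refine ⟨N₀, fun N hN => ?_⟩
  obtain ⟨hb, hs⟩ := hN₀ N hN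
  rw [dist_zero_right]
  have hnexp : ∀ s : ℝ, ‖Complex.exp (-((s : ℝ) : ℂ) ^ 2)‖ ≤ 1 := by
    intro s
    rw [Complex.norm_exp]
    have : (-((s : ℝ) : ℂ) ^ 2).re = -s ^ 2 := by
      rw [← Complex.ofReal_pow, ← Complex.ofReal_neg, Complex.ofReal_re]
    rw [this]
    exact Real.exp_le_one_iff.2 (by nlinarith [sq_nonneg s])
  calc _ ≤ ∑ j, ‖charFun centredChiSq (l N j * t) - Complex.exp (-((l N j * t : ℝ) : ℂ) ^ 2)‖ :=
        norm_prod_sub_prod_le _ _ _ (fun _ => norm_charFun_le_one _) fun _ => hnexp _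
    _ ≤ ∑ j, ε / (t ^ 2 * (|σ| + 1) + 1) * (l N j * t) ^ 2 := by
        refine Finset.sum_le_sum fun j _ => happ _ ?_
        rw [abs_mul, abs_of_nonneg (hl0 N j)]
        exact (mul_le_mul_of_nonneg_right (hlB N j) (abs_nonneg t)).trans_lt hb
    _ = ε / (t ^ 2 * (|σ| + 1) + 1) * (t ^ 2 * ∑ j, l N j ^ 2) := by
        rw [Finset.mul_sum, Finset.mul_sum]
        refine Finset.sum_congr rfl fun j _ => by ring
    _ ≤ ε / (t ^ 2 * (|σ| + 1) + 1) * (t ^ 2 * (|σ| + 1)) := by gcongr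
    _ < ε := by
        rw [div_mul_eq_mul_div, div_lt_iff₀ hC]
        nlinarith

/-- Central limit theorem for the squares of a centred stationary Gaussian sequence with square
summable covariances. -/
theorem tendstoInDistribution_sum_sq [IsProbabilityMeasure P] {Z : ℕ → Ω → ℝ} {r : ℤ → ℝ}
    (hZ : IsGaussianProcess Z P) (h0 : ∀ i, ∫ ω, Z i ω ∂P = 0)
    (hcov : ∀ i j : ℕ, cov[Z i, Z j; P] = r ((i : ℤ) - j)) (hr : Summable fun k => r k ^ 2) :
    TendstoInDistribution
      (fun (N : ℕ) ω => (√(N : ℝ))⁻¹ * ∑ i ∈ Finset.range N, (Z i ω ^ 2 - r 0)) atTop (id : ℝ → ℝ)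
      (fun _ => P) (gaussianReal 0 (2 * ∑' k, r k ^ 2).toNNReal) := by
  have hm : ∀ i, AEMeasurable (Z i) P := hZ.aemeasurable
  have hm' : ∀ N : ℕ, AEMeasurable
      (fun ω => (√(N : ℝ))⁻¹ * ∑ i ∈ Finset.range N, (Z i ω ^ 2 - r 0)) P :=
    fun N => .const_mul (Finset.aemeasurable_fun_sum _ fun i _ => by fun_prop) _
  refine ⟨hm', by fun_prop, ProbabilityMeasure.tendsto_iff_tendsto_charFun.2 fun t => ?_⟩
  simp only [ProbabilityMeasure.coe_mk, Measure.map_id, charFun_gaussianReal]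
  let S : ∀ N : ℕ, Matrix (Fin N) (Fin N) ℝ := fun N => .of fun i j => r ((i : ℕ) - (j : ℕ) : ℤ)
  have hsym : ∀ i j : ℕ, r ((i : ℤ) - j) = r ((j : ℤ) - i) := fun i j => by
    rw [← hcov, covariance_comm, hcov]
  have hS : ∀ N, (S N).IsHermitian := fun N => by
    ext i j
    simp only [S, Matrix.conjTranspose_apply, Matrix.of_apply, star_trivial]
    exact hsym _ _
  have hG : ∀ N : ℕ, HasGaussianLaw (fun ω (i : Fin N) => Z i ω) P := fun N => by
    have h := hZ.hasGaussianLaw (Finset.range N)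
    let L : (Finset.range N → ℝ) →L[ℝ] (Fin N → ℝ) :=
      ContinuousLinearMap.pi fun i => ContinuousLinearMap.proj ⟨i, Finset.mem_range.2 i.2⟩
    exact h.map_fun L
  have key := fun N => charFun_sum_sq_of_hasGaussianLaw (hG N) (fun i => h0 i) (hS N)
    (fun i j => hcov i j)
  have hchar : ∀ N : ℕ,
      charFun (P.map fun ω => (√(N : ℝ))⁻¹ * ∑ i ∈ Finset.range N, (Z i ω ^ 2 - r 0)) t
      = ∏ j, charFun centredChiSq ((√(N : ℝ))⁻¹ * (hS N).eigenvalues j * t) := by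
    intro N
    rw [charFun_map_mul_comp (Finset.aemeasurable_fun_sum _ fun i _ => by fun_prop)]
    have := (key N).2 ((√(N : ℝ))⁻¹ * t)
    simp only [S, Matrix.of_apply, sub_self] at this
    simp_rw [← Fin.sum_univ_eq_sum_range (fun i => Z i _ ^ 2 - r 0)]
    rw [this]
    refine Finset.prod_congr rfl fun j _ => ?_
    congr 1
    ring
  simp_rw [hchar]
  -- The weights are the eigenvalues over `√N`; `B` bounds them through the absolute row sums.
  have hlim := tendsto_prod_charFun_centredChiSq (σ := ∑' k, r k ^ 2)
    (l := fun N j => (√(N : ℝ))⁻¹ * (hS N).eigenvalues j)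
    (B := fun N : ℕ => (√(N : ℝ))⁻¹ * ∑ k ∈ Finset.Icc (-(N : ℤ)) N, |r k|)
    (fun N j => mul_nonneg (by positivity) ((key N).1 j))
    (fun N j => mul_le_mul_of_nonneg_left (eigenvalues_le_of_sum_abs_le (hS N) (fun k => by
      simp only [S, Matrix.of_apply]
      rw [Fin.sum_univ_eq_sum_range (fun j => |r ((k : ℕ) - (j : ℕ) : ℤ)|)]
      exact sum_range_abs_sub_le r k.2) j) (by positivity))
    (tendsto_sum_abs_div_sqrt hr)
    (by
      refine (tendsto_toeplitz_sum hr).congr fun N => ?_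
      simp_rw [mul_pow]
      rw [← Finset.mul_sum, sum_eigenvalues_sq, inv_pow, Real.sq_sqrt (by positivity)]
      congr 1
      simp only [S, Matrix.of_apply]
      rw [← Fin.sum_univ_eq_sum_range
        (fun i => ∑ j ∈ Finset.range N, r ((i : ℕ) - (j : ℕ) : ℤ) ^ 2)]
      refine Finset.sum_congr rfl fun i _ => ?_
      rw [Fin.sum_univ_eq_sum_range (fun j => r ((i : ℕ) - (j : ℕ) : ℤ) ^ 2)])
    t
  convert hlim using 3
  rw [Real.coe_toNNReal _ (mul_nonneg zero_le_two (tsum_nonneg fun _ => sq_nonneg _))]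
  push_cast
  ring

end BSS

/-! ### Delta method -/

namespace BSS

variable {Ω : Type*} [MeasurableSpace Ω] {P : Measure Ω} [IsProbabilityMeasure P]
  {Ω' : Type*} [MeasurableSpace Ω'] {Q : Measure Ω'} [IsProbabilityMeasure Q]
  {Ω'' : Type*} [MeasurableSpace Ω''] {Q' : Measure Ω''} [IsProbabilityMeasure Q']

lemma TendstoInDistribution.congr_law {X : ℕ → Ω → ℝ} {Z : Ω' → ℝ} {Z' : Ω'' → ℝ}
    (h : TendstoInDistribution X atTop Z (fun _ => P) Q) (hZ' : AEMeasurable Z' Q')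
    (hlaw : Q.map Z = Q'.map Z') : TendstoInDistribution X atTop Z' (fun _ => P) Q' := by
  refine ⟨h.forall_aemeasurable, hZ', ?_⟩
  convert! h.tendsto using 2
  exact congrArg 𝓝 (Subtype.ext hlaw.symm)

/-- Portmanteau on the closed set of points at distance at least `ε` from `c`, which the Dirac limit
does not charge. -/
lemma tendstoInMeasure_of_tendstoInDistribution_const {X : ℕ → Ω → ℝ} {c : ℝ}
    (h : TendstoInDistribution X atTop (fun _ => c) (fun _ => P) Q) :
    TendstoInMeasure P X atTop fun _ => c := by
  intro ε hε
  have hF : IsClosed {x : ℝ | ε ≤ edist x c} :=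
    isClosed_le continuous_const (continuous_id.edist continuous_const)
  have hlim := ProbabilityMeasure.limsup_measure_closed_le_of_tendsto h.tendsto hF
  have h0 : (Q.map fun _ : Ω' => c) {x : ℝ | ε ≤ edist x c} = 0 := by
    rw [Measure.map_apply (by fun_prop) hF.measurableSet]
    simp [hε.ne']
  simp only [ProbabilityMeasure.coe_mk, h0] at hlim
  have he : ∀ N, (P.map (X N)) {x : ℝ | ε ≤ edist x c} = P {ω | ε ≤ edist (X N ω) c} := fun N =>
    Measure.map_apply_of_aemeasurable (h.forall_aemeasurable N) hF.measurableSet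
  simp_rw [he] at hlim
  exact tendsto_of_le_liminf_of_limsup_le (by simp) hlim

/-- The delta method for the square root. -/
theorem tendstoInDistribution_sqrt {A : ℕ → Ω → ℝ} {a s : ℝ} (ha : 0 < a)
    (hA0 : ∀ N ω, 0 ≤ A N ω)
    (h : TendstoInDistribution (fun (N : ℕ) ω => √(N : ℝ) * (A N ω - a)) atTop (id : ℝ → ℝ)
      (fun _ => P) (gaussianReal 0 s.toNNReal)) (hA : ∀ N, AEMeasurable (A N) P) :
    TendstoInDistribution (fun (N : ℕ) ω => √(N : ℝ) * (√(A N ω) - √a)) atTop (id : ℝ → ℝ)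
      (fun _ => P) (gaussianReal 0 (s / (4 * a)).toNNReal) ∧
    TendstoInMeasure P (fun N ω => √(A N ω)) atTop fun _ => √a := by
  have hinv : TendstoInMeasure P (fun (N : ℕ) (_ : Ω) => (√(N : ℝ))⁻¹) atTop fun _ => 0 := by
    refine tendstoInMeasure_of_tendsto_ae (fun _ => by fun_prop) (ae_of_all _ fun _ => ?_)
    exact tendsto_inv_atTop_zero.comp (Real.tendsto_sqrt_atTop.comp tendsto_natCast_atTop_atTop)
  have hsq : TendstoInMeasure P (fun N ω => √(A N ω)) atTop fun _ => √a := by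
    -- Slutsky: multiplying the fluctuation by `(√N)⁻¹` and adding `a` recovers `A N` once `N ≥ 1`.
    have h1 := h.continuous_comp_prodMk_of_tendstoInMeasure_const
      (g := fun p : ℝ × ℝ => √(p.2 * p.1 + a)) (by fun_prop) hinv (fun _ => by fun_prop)
    simp only [id_eq, zero_mul, zero_add] at h1
    have h2 := tendstoInMeasure_of_tendstoInDistribution_const h1
    refine h2.congr' ?_ ae_eq_rfl
    filter_upwards [eventually_ge_atTop 1] with N hN
    refine ae_of_all _ fun ω => ?_
    have : √(N : ℝ) ≠ 0 := by positivity
    simp only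
    rw [inv_mul_cancel_left₀ this, sub_add_cancel]
  refine ⟨?_, hsq⟩
  have hsa : 0 < √a := Real.sqrt_pos.2 ha
  -- Uses `√A - √a = (A - a) / (√A + √a)`. The absolute value keeps the denominator positive, so the
  -- map is continuous on the whole plane.
  have h1 := h.continuous_comp_prodMk_of_tendstoInMeasure_const
    (g := fun p : ℝ × ℝ => p.1 / (|p.2| + √a))
    (by
      refine Continuous.div (by fun_prop) (by fun_prop) fun p => ?_
      positivity) hsq (fun N => by fun_prop)
  have h2 : TendstoInDistribution (fun (N : ℕ) ω => √(N : ℝ) * (√(A N ω) - √a)) atTop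
      (fun x : ℝ => x / (|√a| + √a)) (fun _ => P) (gaussianReal 0 s.toNNReal) := by
    refine h1.congr (fun N => ae_of_all _ fun ω => ?_) ae_eq_rfl
    simp only
    rw [abs_of_nonneg (Real.sqrt_nonneg _), div_eq_iff (by positivity), mul_assoc]
    congr 1
    have e1 := Real.sq_sqrt (hA0 N ω)
    have e2 := Real.sq_sqrt ha.le
    linear_combination e1 * (-1) + e2
  refine TendstoInDistribution.congr_law h2 (by fun_prop) ?_
  rw [gaussianReal_map_div_const, Measure.map_id]
  congr 1
  · simp
  · ext
    rw [abs_of_pos hsa]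
    have : (√a + √a) ^ 2 = 4 * a := by
      have := Real.sq_sqrt ha.le
      linear_combination 4 * this
    rw [NNReal.coe_div, NNReal.coe_mk, this, Real.coe_toNNReal', Real.coe_toNNReal',
      ← max_div_div_right (by positivity), zero_div]

end BSS

/-! ### Two-sided Brownian motion and Wiener integrals -/

namespace BSS

variable {Ω : Type*} [MeasurableSpace Ω] {P : Measure Ω}

lemma _root_.ProbabilityTheory.IsGaussianProcess.hasGaussianLaw_linearCombination {T : Type*}
    {X : T → Ω → ℝ} (hX : IsGaussianProcess X P) {ι : Type*} [Fintype ι] (c : ι → ℝ) (t : ι → T) :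
    HasGaussianLaw (fun ω => ∑ i, c i * X (t i) ω) P := by
  classical
  let L : (↥(Finset.image t Finset.univ) → ℝ) →L[ℝ] ℝ :=
    ∑ i, c i • ContinuousLinearMap.proj ⟨t i, by simp⟩
  have := (hX.hasGaussianLaw (Finset.univ.image t)).map_fun L
  convert! this using 2 with ω
  simp [L]

namespace IsTwoSidedBrownian

variable {W : ℝ → Ω → ℝ}

lemma ae_eq_zero (hW : IsTwoSidedBrownian W P) : ∀ᵐ ω ∂P, W 0 ω = 0 := by
  simpa using hW.pos.eval_zero_ae_eq_zero

/-- One of the two terms is `W 0 = 0`. A linear combination of values of `W` thus splits into two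
independent Gaussian parts, one from each half-line. -/
lemma ae_eq_add (hW : IsTwoSidedBrownian W P) :
    ∀ᵐ ω ∂P, ∀ t : ℝ, W t ω = W (t.toNNReal : ℝ) ω + W (-((-t).toNNReal : ℝ)) ω := by
  filter_upwards [hW.ae_eq_zero] with ω hω t
  rcases le_total 0 t with h | h
  · rw [Real.coe_toNNReal t h, Real.toNNReal_of_nonpos (by linarith)]
    simp [hω]
  · rw [Real.coe_toNNReal (-t) (by linarith), Real.toNNReal_of_nonpos h]
    simp [hω]

lemma hasGaussianLaw_linearCombination (hW : IsTwoSidedBrownian W P) {ι : Type*} [Fintype ι]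
    (c t : ι → ℝ) : HasGaussianLaw (fun ω => ∑ i, c i * W (t i) ω) P := by
  have h1 := hW.pos.isGaussianProcess.hasGaussianLaw_linearCombination c fun i => (t i).toNNReal
  have h2 := hW.neg.isGaussianProcess.hasGaussianLaw_linearCombination c fun i => (-t i).toNNReal
  have hind : IndepFun (fun ω => ∑ i, c i * W ((t i).toNNReal : ℝ) ω)
      (fun ω => ∑ i, c i * W (-((-t i).toNNReal : ℝ)) ω) P :=
    hW.indep.comp (φ := fun x : ℝ≥0 → ℝ => ∑ i, c i * x (t i).toNNReal)
      (ψ := fun x : ℝ≥0 → ℝ => ∑ i, c i * x (-t i).toNNReal) (by fun_prop) (by fun_prop)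
  refine (hind.hasGaussianLaw h1 h2).fun_add.congr ?_
  filter_upwards [hW.ae_eq_add] with ω hω
  rw [← Finset.sum_add_distrib]
  refine Finset.sum_congr rfl fun i _ => ?_
  rw [hω (t i)]
  ring

lemma hasGaussianLaw (hW : IsTwoSidedBrownian W P) (t : ℝ) : HasGaussianLaw (W t) P := by
  simpa using hW.hasGaussianLaw_linearCombination (ι := Unit) (fun _ => 1) (fun _ => t)

lemma integral_eq_zero (hW : IsTwoSidedBrownian W P) (t : ℝ) : ∫ ω, W t ω ∂P = 0 := by
  rcases le_total 0 t with h | h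
  · simpa [h] using hW.pos.integral_eval t.toNNReal
  · simpa [h] using hW.neg.integral_eval (-t).toNNReal

lemma covariance_eq (hW : IsTwoSidedBrownian W P) (s t : ℝ) :
    cov[W s, W t; P] = (|s| + |t| - |s - t|) / 2 := by
  wlog hst : s ≤ t generalizing s t
  · rw [covariance_comm, this t s (by linarith), abs_sub_comm s t]
    ring
  rw [abs_sub_comm, abs_of_nonneg (sub_nonneg.2 hst)]
  rcases le_total 0 s with h | h
  · have h' := h.trans hst
    have := hW.pos.covariance_eval s.toNNReal t.toNNReal
    simp only [Real.coe_toNNReal _ h, Real.coe_toNNReal _ h'] at this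
    rw [this, min_eq_left (Real.toNNReal_le_toNNReal hst), Real.coe_toNNReal _ h, abs_of_nonneg h,
      abs_of_nonneg h']
    ring
  rcases le_total 0 t with h' | h'
  · have hind : IndepFun (W s) (W t) P := by
      have : IndepFun (fun ω => W (-((-s).toNNReal : ℝ)) ω) (fun ω => W (t.toNNReal : ℝ) ω) P :=
        hW.indep.symm.comp (φ := fun x : ℝ≥0 → ℝ => x (-s).toNNReal)
          (ψ := fun x : ℝ≥0 → ℝ => x t.toNNReal) (measurable_pi_apply _) (measurable_pi_apply _)
      simpa [Function.comp_def, h, h'] using this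
    rw [hind.covariance_eq_zero (hW.hasGaussianLaw s).memLp_two (hW.hasGaussianLaw t).memLp_two,
      abs_of_nonneg h', abs_of_nonpos h]
    ring
  · have := hW.neg.covariance_eval (-s).toNNReal (-t).toNNReal
    have hs' : 0 ≤ -s := by linarith
    have ht' : 0 ≤ -t := by linarith
    simp only [Real.coe_toNNReal _ hs', Real.coe_toNNReal _ ht', neg_neg] at this
    rw [this, min_eq_right (Real.toNNReal_le_toNNReal (neg_le_neg hst)), Real.coe_toNNReal _ ht',
      abs_of_nonpos h, abs_of_nonpos h']
    ring

lemma memLp_two (hW : IsTwoSidedBrownian W P) (t : ℝ) : MemLp (W t) 2 P :=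
  (hW.hasGaussianLaw t).memLp_two

lemma covariance_sub_sub (hW : IsTwoSidedBrownian W P) {a b a' b' : ℝ} (h : a ≤ b) (h' : a' ≤ b') :
    cov[fun ω => W b ω - W a ω, fun ω => W b' ω - W a' ω; P]
      = volume.real (Set.Ioc a b ∩ Set.Ioc a' b') := by
  have hP := (hW.hasGaussianLaw 0).isProbabilityMeasure
  have hm := hW.memLp_two
  rw [covariance_fun_sub_fun_sub (hm _) (hm _) (hm _) (hm _), hW.covariance_eq, hW.covariance_eq,
    hW.covariance_eq, hW.covariance_eq, Set.Ioc_inter_Ioc, Real.volume_real_Ioc]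
  grind

lemma hasGaussianLaw_stepFun (hW : IsTwoSidedBrownian W P) (φ : StepFun) :
    HasGaussianLaw (φ.integral W) P := by
  have := hW.hasGaussianLaw_linearCombination (Sum.elim φ.c fun i => -φ.c i) (Sum.elim φ.b φ.a)
  refine this.congr (ae_of_all _ fun ω => ?_)
  simp only [Fintype.sum_sum_type, Sum.elim_inl, Sum.elim_inr, StepFun.integral]
  rw [← Finset.sum_add_distrib]
  refine Finset.sum_congr rfl fun i _ => by ring

lemma integral_stepFun (hW : IsTwoSidedBrownian W P) (φ : StepFun) :
    ∫ ω, φ.integral W ω ∂P = 0 := by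
  have hP := (hW.hasGaussianLaw 0).isProbabilityMeasure
  have hi : ∀ t, Integrable (W t) P := fun t => (hW.hasGaussianLaw t).integrable
  simp only [StepFun.integral]
  have hd : ∀ i, Integrable (fun ω => φ.c i * (W (φ.b i) ω - W (φ.a i) ω)) P := fun i =>
    ((hi _).sub (hi _)).const_mul _
  rw [integral_finsetSum _ fun i _ => hd i]
  refine Finset.sum_eq_zero fun i _ => ?_
  rw [integral_const_mul, integral_sub (hi _) (hi _), hW.integral_eq_zero, hW.integral_eq_zero]
  simp

/-- The Itô isometry for step functions. -/
lemma variance_stepFun (hW : IsTwoSidedBrownian W P) (φ : StepFun) :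
    Var[φ.integral W; P] = ∫ s, φ.toFun s ^ 2 := by
  have hP := (hW.hasGaussianLaw 0).isProbabilityMeasure
  have hm := hW.memLp_two
  have hd : ∀ i, MemLp (fun ω => φ.c i * (W (φ.b i) ω - W (φ.a i) ω)) 2 P := fun i =>
    ((hm _).sub (hm _)).const_mul _
  rw [← covariance_self (hW.hasGaussianLaw_stepFun φ).aemeasurable]
  change cov[fun ω => ∑ i, φ.c i * (W (φ.b i) ω - W (φ.a i) ω),
    fun ω => ∑ i, φ.c i * (W (φ.b i) ω - W (φ.a i) ω); P] = _
  rw [covariance_fun_sum_fun_sum hd hd]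
  have hmeas : ∀ i j, MeasurableSet (Set.Ioc (φ.a i) (φ.b i) ∩ Set.Ioc (φ.a j) (φ.b j)) :=
    fun i j => measurableSet_Ioc.inter measurableSet_Ioc
  have hsq : ∀ s, φ.toFun s ^ 2 = ∑ i, ∑ j,
      (Set.Ioc (φ.a i) (φ.b i) ∩ Set.Ioc (φ.a j) (φ.b j)).indicator
        (fun _ => φ.c i * φ.c j) s := by
    intro s
    rw [StepFun.toFun, sq, Finset.sum_mul_sum]
    refine Finset.sum_congr rfl fun i _ => Finset.sum_congr rfl fun j _ => ?_
    rw [Set.inter_indicator_mul]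
  have hint : ∀ i j, Integrable ((Set.Ioc (φ.a i) (φ.b i) ∩ Set.Ioc (φ.a j) (φ.b j)).indicator
      (fun _ => φ.c i * φ.c j)) := by
    intro i j
    rw [integrable_indicator_iff (hmeas i j)]
    refine integrableOn_const ?_
    exact ((measure_mono Set.inter_subset_left).trans_lt measure_Ioc_lt_top).ne
  simp_rw [hsq]
  rw [integral_finsetSum _ fun i _ => integrable_finsetSum _ fun j _ => hint i j]
  refine Finset.sum_congr rfl fun i _ => ?_
  rw [integral_finsetSum _ fun j _ => hint i j]
  refine Finset.sum_congr rfl fun j _ => ?_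
  rw [covariance_const_mul_left, covariance_const_mul_right,
    hW.covariance_sub_sub (φ.a_le_b i) (φ.a_le_b j), integral_indicator_const _ (hmeas i j),
    smul_eq_mul]
  ring

end IsTwoSidedBrownian

lemma StepFun.memLp_toFun (φ : StepFun) : MemLp φ.toFun 2 volume := by
  have : φ.toFun = fun s => ∑ i, (Set.Ioc (φ.a i) (φ.b i)).indicator (fun _ => φ.c i) s := rfl
  rw [this]
  exact memLp_finsetSum _ fun i _ => memLp_indicator_const 2 measurableSet_Ioc _
    (Or.inr measure_Ioc_lt_top.ne)

lemma integral_sq_eq_eLpNorm {α : Type*} [MeasurableSpace α] {μ : Measure α} {f : α → ℝ}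
    (hf : MemLp f 2 μ) : ∫ x, f x ^ 2 ∂μ = (eLpNorm f 2 μ).toReal ^ 2 := by
  have h := hf.eLpNorm_eq_integral_rpow_norm (by norm_num) (by norm_num)
  have h0 : 0 ≤ ∫ x, f x ^ 2 ∂μ := integral_nonneg fun _ => sq_nonneg _
  rw [h]
  simp only [ENNReal.toReal_ofNat, Real.norm_eq_abs, Real.rpow_ofNat, sq_abs]
  rw [ENNReal.toReal_ofReal (by positivity), ← Real.rpow_natCast, ← Real.rpow_mul h0]
  norm_num

lemma tendsto_eLpNorm_toReal {α : Type*} [MeasurableSpace α] {μ : Measure α} {f : α → ℝ}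
    {φ : ℕ → α → ℝ} (hf : MemLp f 2 μ) (hφ : ∀ m, MemLp (φ m) 2 μ)
    (h : Tendsto (fun m => eLpNorm (fun s => φ m s - f s) 2 μ) atTop (𝓝 0)) :
    Tendsto (fun m => (eLpNorm (φ m) 2 μ).toReal) atTop (𝓝 (eLpNorm f 2 μ).toReal) := by
  have h1 := (Lp.tendsto_Lp_iff_tendsto_eLpNorm'' φ hφ f hf).2 h
  have h2 := h1.norm
  simpa using h2

namespace IsWienerIntegral

variable {W : ℝ → Ω → ℝ} {f f' : ℝ → ℝ} {I I' : Ω → ℝ}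

/-- Wiener integrals are centred Gaussian. -/
lemma hasLaw (hW : IsTwoSidedBrownian W P) (hf : MemLp f 2 volume)
    (h : IsWienerIntegral W P f I) : HasLaw I (gaussianReal 0 (∫ s, f s ^ 2).toNNReal) P := by
  have hP := (hW.hasGaussianLaw 0).isProbabilityMeasure
  obtain ⟨hI, φ, hφ, hφI⟩ := h
  have hm : ∀ m, AEMeasurable ((φ m).integral W) P := fun m =>
    (hW.hasGaussianLaw_stepFun (φ m)).aemeasurable
  have hvar : Tendsto (fun m => ∫ s, (φ m).toFun s ^ 2) atTop (𝓝 (∫ s, f s ^ 2)) := by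
    simp_rw [integral_sq_eq_eLpNorm hf, fun m => integral_sq_eq_eLpNorm (φ m).memLp_toFun]
    exact (tendsto_eLpNorm_toReal hf (fun m => (φ m).memLp_toFun) hφ).pow 2
  have hmeas : TendstoInMeasure P (fun m => (φ m).integral W) atTop I :=
    tendstoInMeasure_of_tendsto_eLpNorm (p := 2) (by norm_num)
      (fun m => (hm m).aestronglyMeasurable) hI.1 hφI
  have hdist := hmeas.tendstoInDistribution hm
  refine ⟨hI.1.aemeasurable, ?_⟩
  have hPI : IsProbabilityMeasure (P.map I) := Measure.isProbabilityMeasure_map hI.1.aemeasurable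
  -- The laws of the approximating integrals converge to that of `I`, while their variances converge
  -- to `∫ f ^ 2`; uniqueness of limits identifies the characteristic function.
  refine Measure.ext_of_charFun (funext fun t => ?_)
  have h1 := ProbabilityMeasure.tendsto_iff_tendsto_charFun.1 hdist.tendsto t
  refine tendsto_nhds_unique h1 ?_
  simp only [ProbabilityMeasure.coe_mk]
  simp_rw [fun m => (hW.hasGaussianLaw_stepFun (φ m)).map_eq_gaussianReal, hW.integral_stepFun,
    hW.variance_stepFun, charFun_gaussianReal]
  have h2 : ∀ g : ℝ → ℝ, 0 ≤ ∫ s, g s ^ 2 := fun g => integral_nonneg fun _ => sq_nonneg _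
  simp_rw [Real.coe_toNNReal _ (h2 _)]
  have hc : Continuous fun v : ℝ => Complex.exp (t * (0 : ℝ) * Complex.I - v * t ^ 2 / 2) := by
    fun_prop
  exact (hc.tendsto _).comp hvar

lemma const_mul (h : IsWienerIntegral W P f I) (c : ℝ) :
    IsWienerIntegral W P (fun s => c * f s) (fun ω => c * I ω) := by
  obtain ⟨hI, φ, hφ, hφI⟩ := h
  have hlim : ∀ {u : ℕ → ℝ≥0∞}, Tendsto u atTop (𝓝 0) →
      Tendsto (fun m => ‖c‖ₑ * u m) atTop (𝓝 0) := fun hu => by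
    simpa using ENNReal.Tendsto.const_mul hu (Or.inr (by simp))
  refine ⟨hI.const_mul c, fun m => ⟨(φ m).n, fun i => c * (φ m).c i, (φ m).a, (φ m).b,
    (φ m).a_le_b⟩, (hlim hφ).congr fun m => ?_, (hlim hφI).congr fun m => ?_⟩
  · rw [← eLpNorm_const_smul]
    congr 1
    ext s
    simp only [Pi.smul_apply, smul_eq_mul, StepFun.toFun, mul_sub, Finset.mul_sum]
    congr 1
    refine Finset.sum_congr rfl fun i _ => ?_
    rw [Set.indicator_const_mul]
  · rw [← eLpNorm_const_smul]
    congr 1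
    ext s
    simp only [Pi.smul_apply, smul_eq_mul, StepFun.integral, mul_sub, Finset.mul_sum, mul_assoc]

end IsWienerIntegral

/-- The sum of two step functions. -/
def StepFun.add (φ ψ : StepFun) : StepFun where
  n := φ.n + ψ.n
  c := Fin.append φ.c ψ.c
  a := Fin.append φ.a ψ.a
  b := Fin.append φ.b ψ.b
  a_le_b i := by
    refine Fin.addCases (fun i => ?_) (fun i => ?_) i
    · simpa using φ.a_le_b i
    · simpa using ψ.a_le_b i

lemma StepFun.add_toFun (φ ψ : StepFun) (s : ℝ) :
    (φ.add ψ).toFun s = φ.toFun s + ψ.toFun s := by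
  refine (Fin.sum_univ_add (fun i : Fin (φ.n + ψ.n) => _)).trans ?_
  simp [StepFun.toFun, StepFun.add]

lemma StepFun.add_integral {Ω : Type*} (φ ψ : StepFun) (W : ℝ → Ω → ℝ) (ω : Ω) :
    (φ.add ψ).integral W ω = φ.integral W ω + ψ.integral W ω := by
  refine (Fin.sum_univ_add (fun i : Fin (φ.n + ψ.n) => _)).trans ?_
  simp [StepFun.integral, StepFun.add]

namespace IsWienerIntegral

variable {W : ℝ → Ω → ℝ} {f f' : ℝ → ℝ} {I I' : Ω → ℝ}

lemma add (hW : IsTwoSidedBrownian W P) (hf : MemLp f 2 volume) (hf' : MemLp f' 2 volume)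
    (h : IsWienerIntegral W P f I) (h' : IsWienerIntegral W P f' I') :
    IsWienerIntegral W P (fun s => f s + f' s) (fun ω => I ω + I' ω) := by
  obtain ⟨hI, φ, hφ, hφI⟩ := h
  obtain ⟨hI', ψ, hψ, hψI⟩ := h'
  have hm : ∀ φ : StepFun, MemLp (φ.integral W) 2 P := fun φ =>
    (hW.hasGaussianLaw_stepFun φ).memLp_two
  refine ⟨hI.add hI', fun m => (φ m).add (ψ m), ?_, ?_⟩
  · refine tendsto_of_tendsto_of_tendsto_of_le_of_le tendsto_const_nhds
      (by simpa using hφ.add hψ) (fun _ => zero_le) fun m => ?_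
    have := eLpNorm_add_le ((φ m).memLp_toFun.sub hf).1 ((ψ m).memLp_toFun.sub hf').1
      (p := 2) (by norm_num)
    convert! this using 2
    ext s
    simp only [StepFun.add_toFun, Pi.add_apply, Pi.sub_apply]
    ring
  · refine tendsto_of_tendsto_of_tendsto_of_le_of_le tendsto_const_nhds
      (by simpa using hφI.add hψI) (fun _ => zero_le) fun m => ?_
    have := eLpNorm_add_le ((hm (φ m)).sub hI).1 ((hm (ψ m)).sub hI').1
      (p := 2) (by norm_num)
    convert! this using 2
    ext s
    simp only [StepFun.add_integral, Pi.add_apply, Pi.sub_apply]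
    ring

end IsWienerIntegral

end BSS

/-! ### Joint Gaussianity and covariance of Wiener integrals -/

namespace BSS

variable {Ω : Type*} [MeasurableSpace Ω] {P : Measure Ω}

namespace IsWienerIntegral

variable {W : ℝ → Ω → ℝ} {ι : Type*} {f : ι → ℝ → ℝ} {I : ι → Ω → ℝ}

lemma zero (W : ℝ → Ω → ℝ) : IsWienerIntegral W P (fun _ => 0) (fun _ => 0) := by
  refine ⟨MemLp.zero', fun _ => ⟨0, Fin.elim0, Fin.elim0, Fin.elim0, fun i => i.elim0⟩, ?_, ?_⟩ <;>
    simp [StepFun.toFun, StepFun.integral]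

lemma sum (hW : IsTwoSidedBrownian W P) (hf : ∀ i, MemLp (f i) 2 volume)
    (h : ∀ i, IsWienerIntegral W P (f i) (I i)) (s : Finset ι) (c : ι → ℝ) :
    IsWienerIntegral W P (fun x => ∑ i ∈ s, c i * f i x) (fun ω => ∑ i ∈ s, c i * I i ω) := by
  classical
  induction s using Finset.induction_on with
  | empty => simpa using zero W
  | insert i s his ih =>
    simp_rw [Finset.sum_insert his]
    exact add hW ((hf i).const_mul _) (memLp_finsetSum _ fun j _ => (hf j).const_mul _)
      ((h i).const_mul _) ih

lemma sub {f₁ f₂ : ℝ → ℝ} {I₁ I₂ : Ω → ℝ} (hW : IsTwoSidedBrownian W P)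
    (hf₁ : MemLp f₁ 2 volume) (hf₂ : MemLp f₂ 2 volume)
    (h₁ : IsWienerIntegral W P f₁ I₁) (h₂ : IsWienerIntegral W P f₂ I₂) :
    IsWienerIntegral W P (fun x => f₁ x - f₂ x) (fun ω => I₁ ω - I₂ ω) := by
  simpa [sub_eq_add_neg] using add hW hf₁ (hf₂.const_mul (-1)) h₁ (h₂.const_mul (-1))

/-- Every linear functional of finitely many Wiener integrals is the Wiener integral of the same
combination of integrands, hence Gaussian. -/
lemma isGaussianProcess (hW : IsTwoSidedBrownian W P) (hf : ∀ i, MemLp (f i) 2 volume)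
    (h : ∀ i, IsWienerIntegral W P (f i) (I i)) : IsGaussianProcess I P where
  hasGaussianLaw J := by
    classical
    have hm : AEMeasurable (fun ω => J.restrict (I · ω)) P :=
      aemeasurable_pi_lambda _ fun i => (h i).1.1.aemeasurable
    refine ⟨⟨fun L => ?_⟩⟩
    let c : J → ℝ := fun i => L (fun j => if i = j then 1 else 0)
    have hsum := sum (ι := J) (f := fun i => f i) (I := fun i => I i) hW (fun i => hf i)
      (fun i => h i) Finset.univ c
    have hmem : MemLp (fun x => ∑ i : J, c i * f i x) 2 volume :=
      memLp_finsetSum _ fun j _ => (hf j).const_mul _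
    have hlaw := hsum.hasLaw hW hmem
    have hG : HasGaussianLaw L (P.map fun ω => J.restrict (I · ω)) := by
      constructor
      rw [AEMeasurable.map_map_of_aemeasurable (by fun_prop) hm]
      have : (L ∘ fun ω => J.restrict (I · ω))
          = fun ω => ∑ i : J, c i * I i ω := by
        ext ω
        rw [Function.comp_apply, ← ContinuousLinearMap.coe_coe, LinearMap.pi_apply_eq_sum_univ]
        refine Finset.sum_congr rfl fun i _ => ?_
        simp [c, mul_comm]
      rw [this, hlaw.map_eq]
      infer_instance
    exact hG.map_eq_gaussianReal

lemma integral_eq_zero {f : ℝ → ℝ} {I : Ω → ℝ} (hW : IsTwoSidedBrownian W P)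
    (hf : MemLp f 2 volume) (h : IsWienerIntegral W P f I) : ∫ ω, I ω ∂P = 0 := by
  rw [(h.hasLaw hW hf).integral_eq, integral_id_gaussianReal]

lemma variance_eq {f : ℝ → ℝ} {I : Ω → ℝ} (hW : IsTwoSidedBrownian W P)
    (hf : MemLp f 2 volume) (h : IsWienerIntegral W P f I) : Var[I; P] = ∫ s, f s ^ 2 := by
  rw [(h.hasLaw hW hf).variance_eq, variance_id_gaussianReal,
    Real.coe_toNNReal _ (integral_nonneg fun _ => sq_nonneg _)]

/-- The Itô isometry. -/
lemma covariance_eq {f₁ f₂ : ℝ → ℝ} {I₁ I₂ : Ω → ℝ} (hW : IsTwoSidedBrownian W P)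
    (hf₁ : MemLp f₁ 2 volume) (hf₂ : MemLp f₂ 2 volume)
    (h₁ : IsWienerIntegral W P f₁ I₁) (h₂ : IsWienerIntegral W P f₂ I₂) :
    cov[I₁, I₂; P] = ∫ s, f₁ s * f₂ s := by
  have hP := (hW.hasGaussianLaw 0).isProbabilityMeasure
  -- Polarisation of the variance identity.
  have e := (add hW hf₁ hf₂ h₁ h₂).variance_eq hW (hf₁.add hf₂)
  rw [variance_fun_add h₁.1 h₂.1, h₁.variance_eq hW hf₁, h₂.variance_eq hW hf₂] at e
  have h3 : ∫ s, (f₁ s + f₂ s) ^ 2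
      = (∫ s, f₁ s ^ 2) + (∫ s, f₂ s ^ 2) + 2 * ∫ s, f₁ s * f₂ s := by
    have i12 : Integrable (fun s => f₁ s * f₂ s) := hf₁.integrable_mul hf₂
    have i3 : Integrable (fun s => f₁ s ^ 2 + f₂ s ^ 2) := hf₁.integrable_sq.add hf₂.integrable_sq
    rw [← integral_add hf₁.integrable_sq hf₂.integrable_sq, ← integral_const_mul,
      ← integral_add i3 (i12.const_mul 2)]
    congr 1
    ext s
    ring
  simp only [Pi.add_apply] at e
  linarith

end IsWienerIntegral

/-! ### Autocovariance and nondegeneracy of the kernel -/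

section Kernel

variable {g : ℝ → ℝ}

lemma autocov_eq_integral (hg0 : ∀ x ≤ 0, g x = 0) (h : ℝ) :
    autocov g h = ∫ x, g x * g (x + |h|) := by
  rw [autocov]
  refine setIntegral_eq_integral_of_forall_compl_eq_zero fun x hx => ?_
  rw [hg0 x (not_lt.1 hx), zero_mul]

lemma integral_shift_mul_shift (hg0 : ∀ x ≤ 0, g x = 0) (t u : ℝ) :
    ∫ s, g (t - s) * g (u - s) = autocov g (t - u) := by
  wlog htu : t ≤ u generalizing t u
  · have := this u t (by linarith)
    simp_rw [mul_comm (g (u - _))] at this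
    rw [this, autocov, autocov, abs_sub_comm]
  rw [autocov_eq_integral hg0, abs_sub_comm, abs_of_nonneg (sub_nonneg.2 htu),
    ← integral_sub_left_eq_self _ _ t]
  refine integral_congr_ae (ae_of_all _ fun s => ?_)
  simp only
  rw [show t - (t - s) = s by ring, show u - (t - s) = s + (u - t) by ring]

lemma integral_mul_shift (hg0 : ∀ x ≤ 0, g x = 0) (h : ℝ) :
    ∫ s, g s * g (s + h) = autocov g h := by
  rw [← integral_sub_left_eq_self (fun s => g s * g (s + h)) _ 0]
  have := integral_shift_mul_shift hg0 0 h
  rw [autocov, zero_sub, abs_neg, ← autocov] at this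
  rw [← this]
  congr 1
  ext s
  congr 2
  ring

lemma memLp_shift (hg : MemLp g 2 volume) (t : ℝ) : MemLp (fun s => g (t - s)) 2 volume :=
  hg.comp_measurePreserving (Measure.measurePreserving_sub_left volume t)

/-- A square-integrable kernel supported on the positive half-line which is invariant under a
translation vanishes. -/
lemma ae_eq_zero_of_shift_ae_eq (hg0 : ∀ x ≤ 0, g x = 0) {Δ : ℝ} (hΔ : 0 < Δ)
    (h : ∀ᵐ x : ℝ, g x = g (x - Δ)) : g =ᵐ[volume] fun _ => 0 := by
  have hn : ∀ n : ℕ, ∀ᵐ x : ℝ, g x = g (x - n * Δ) := by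
    intro n
    induction n with
    | zero => simp
    | succ n ih =>
      have h' := (measurePreserving_sub_right volume (n * Δ)).quasiMeasurePreserving.ae h
      filter_upwards [ih, h'] with x hx hx'
      rw [hx, hx']
      congr 1
      push_cast
      ring
  filter_upwards [ae_all_iff.2 hn] with x hx
  -- Enough translations carry `x` into the half-line where `g` vanishes.
  obtain ⟨n, hn⟩ := exists_nat_ge (x / Δ)
  rw [hx n]
  refine hg0 _ ?_
  rw [div_le_iff₀ hΔ] at hn
  linarith

/-- Were the integral zero, `g` would be almost everywhere invariant under translation by `Δ`. This
is the source of `τ > 0`. -/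
lemma integral_sq_shift_sub_pos (hg : MemLp g 2 volume) (hg0 : ∀ x ≤ 0, g x = 0)
    (hne : ¬ (g =ᵐ[volume] fun _ => 0)) {Δ : ℝ} (hΔ : 0 < Δ) :
    0 < ∫ s, (g (Δ - s) - g (0 - s)) ^ 2 := by
  refine lt_of_le_of_ne (integral_nonneg fun _ => sq_nonneg _) fun h => hne ?_
  have hz := (integral_eq_zero_iff_of_nonneg (fun _ => sq_nonneg _)
    ((memLp_shift hg Δ).sub (memLp_shift hg 0)).integrable_sq).1 h.symm
  refine ae_eq_zero_of_shift_ae_eq hg0 hΔ ?_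
  have h' := (Measure.measurePreserving_sub_left volume Δ).quasiMeasurePreserving.ae hz
  filter_upwards [h'] with x hx
  have hx' : g (Δ - (Δ - x)) - g (0 - (Δ - x)) = 0 := by
    simpa using hx
  rw [sub_sub_cancel, zero_sub, neg_sub] at hx'
  linarith

end Kernel

/-! ### Series of covariances -/

lemma summable_mul_of_summable_sq {a b : ℤ → ℝ} (ha : Summable fun k => a k ^ 2)
    (hb : Summable fun k => b k ^ 2) : Summable fun k => a k * b k := by
  refine Summable.of_norm_bounded (ha.add hb) fun k => ?_
  rw [Real.norm_eq_abs, abs_le]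
  constructor <;> nlinarith [sq_nonneg (a k + b k), sq_nonneg (a k - b k)]

/-- The square sum of the second differences of a square summable sequence. -/
lemma tsum_sq_second_difference {a : ℤ → ℝ} (ha : Summable fun k => a k ^ 2) :
    (Summable fun k => (2 * a k - a (k - 1) - a (k + 1)) ^ 2) ∧
    Summable (fun k => a k * a (k - 1)) ∧ Summable (fun k => a (k + 1) * a (k - 1)) ∧
    ∑' k, (2 * a k - a (k - 1) - a (k + 1)) ^ 2 = 6 * ∑' k, a k ^ 2
      - 8 * ∑' k, a k * a (k - 1) + 2 * ∑' k, a (k + 1) * a (k - 1) := by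
  have hm : HasSum (fun k => a (k - 1) ^ 2) (∑' k, a k ^ 2) :=
    (Equiv.subRight (1 : ℤ)).hasSum_iff (f := fun k => a k ^ 2) |>.2 ha.hasSum
  have hp : HasSum (fun k => a (k + 1) ^ 2) (∑' k, a k ^ 2) :=
    (Equiv.addRight (1 : ℤ)).hasSum_iff (f := fun k => a k ^ 2) |>.2 ha.hasSum
  have h1 := summable_mul_of_summable_sq ha hm.summable
  have h2 := summable_mul_of_summable_sq hp.summable hm.summable
  -- The two neighbouring cross terms of the expanded square have equal sums, by a shift of the
  -- index.
  have h3 : HasSum (fun k => a (k + 1) * a k) (∑' k, a k * a (k - 1)) := by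
    have := (Equiv.addRight (1 : ℤ)).hasSum_iff (f := fun k => a k * a (k - 1)) |>.2 h1.hasSum
    simpa [Function.comp_def] using this
  have key := (((((ha.hasSum.mul_left 4).add hm).add hp).sub (h1.hasSum.mul_left 4)).sub
    (h3.mul_left 4)).add (h2.hasSum.mul_left 2)
  have hfun : (fun k => (2 * a k - a (k - 1) - a (k + 1)) ^ 2) = fun k => 4 * a k ^ 2
      + a (k - 1) ^ 2 + a (k + 1) ^ 2 - 4 * (a k * a (k - 1)) - 4 * (a (k + 1) * a k)
      + 2 * (a (k + 1) * a (k - 1)) := by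
    ext k
    ring
  rw [hfun]
  refine ⟨key.summable, h1, h2, ?_⟩
  rw [key.tsum_eq]
  ring

lemma term01_eq (g : ℝ → ℝ) (Δ : ℝ) (k : ℤ) :
    term01 g Δ k = 2 * (autocov g (k * Δ) * autocov g (((k - 1 : ℤ) : ℝ) * Δ)) := by
  rw [term01]
  push_cast
  ring

lemma term11_eq (g : ℝ → ℝ) (Δ : ℝ) (k : ℤ) :
    term11 g Δ k = autocov g (k * Δ) ^ 2
      + autocov g (((k + 1 : ℤ) : ℝ) * Δ) * autocov g (((k - 1 : ℤ) : ℝ) * Δ) := by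
  rw [term11]
  push_cast
  ring

end BSS

/-! ### Assembly of the theorem -/

theorem mainTheorem4 {Ω : Type*} [MeasurableSpace Ω] (P : Measure Ω) [IsProbabilityMeasure P]
    (g : ℝ → ℝ) (hg_nonneg : ∀ x, 0 ≤ g x) (hg_zero : ∀ x ≤ 0, g x = 0)
    (hg_L2 : MemLp g 2 volume) (hg_ne : ¬ (g =ᵐ[volume] fun _ => 0))
    (W : ℝ → Ω → ℝ) (hW : BSS.IsTwoSidedBrownian W P)
    (X : ℝ → Ω → ℝ) (hX : BSS.IsGaussianCore g W P X)
    (Δ : ℝ) (hΔ : 0 < Δ)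
    (hsum : Summable fun k : ℤ => (∫ s : ℝ, |g s * g (s + k * Δ)|) ^ 2) :
    -- the limit law is well defined
    0 < BSS.scaleFactor P X Δ ∧
    Summable (BSS.term00 g Δ) ∧ Summable (BSS.term01 g Δ) ∧ Summable (BSS.term11 g Δ) ∧
    0 ≤ BSS.asympVar g Δ ∧
    -- central limit theorem
    TendstoInDistribution
      (fun (N : ℕ) ω => √(N : ℝ) * (BSS.scaleEstimator X Δ N ω - BSS.scaleFactor P X Δ))
      atTop (id : ℝ → ℝ) (fun _ => P)
      (gaussianReal 0 (Real.toNNReal (BSS.asympVar g Δ / (4 * BSS.scaleFactor P X Δ ^ 2)))) ∧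
    -- consistency
    TendstoInMeasure P (fun (N : ℕ) ω => BSS.scaleEstimator X Δ N ω) atTop
      (fun _ => BSS.scaleFactor P X Δ) := by
  set a : ℤ → ℝ := fun k => BSS.autocov g (k * Δ) with ha_def
  -- Nonnegativity of `g` removes the absolute value, so the integral in the hypothesis is `a k`
  -- itself.
  have ha : Summable fun k => a k ^ 2 := by
    refine hsum.congr fun k => ?_
    simp only [ha_def]
    rw [← BSS.integral_mul_shift hg_zero]
    simp_rw [abs_of_nonneg (mul_nonneg (hg_nonneg _) (hg_nonneg _))]
  obtain ⟨hr, h01, h11, hv⟩ := BSS.tsum_sq_second_difference ha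
  set r : ℤ → ℝ := fun k => 2 * a k - a (k - 1) - a (k + 1) with hr_def
  have ht00 : BSS.term00 g Δ = fun k => 2 * a k ^ 2 := rfl
  have ht01 : BSS.term01 g Δ = fun k => 2 * (a k * a (k - 1)) := funext (BSS.term01_eq g Δ)
  have ht11 : BSS.term11 g Δ = fun k => a k ^ 2 + a (k + 1) * a (k - 1) :=
    funext (BSS.term11_eq g Δ)
  have hvar : BSS.asympVar g Δ = 2 * ∑' k, r k ^ 2 := by
    rw [BSS.asympVar, ht00, ht01, ht11, tsum_mul_left, tsum_mul_left, ha.tsum_add h11, hv]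
    ring
  have hv0 : 0 ≤ BSS.asympVar g Δ := by
    rw [hvar]
    exact mul_nonneg zero_le_two (tsum_nonneg fun _ => sq_nonneg _)
  -- The indicator is redundant: `g (t - s)` already vanishes for `s ≥ t`.
  have hXW : ∀ t, BSS.IsWienerIntegral W P (fun s => g (t - s)) (X t) := by
    intro t
    have : (Set.Iic t).indicator (fun s => g (t - s)) = fun s => g (t - s) := by
      refine Set.indicator_eq_self.2 fun s hs => ?_
      by_contra hst
      exact hs (hg_zero _ (by simpa using le_of_lt (not_le.1 hst)))
    exact this ▸ hX t
  have hgt := BSS.memLp_shift hg_L2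
  let Z : ℕ → Ω → ℝ := fun i ω => X (((i : ℝ) + 1) * Δ) ω - X (i * Δ) ω
  let f : ℕ → ℝ → ℝ := fun i s => g (((i : ℝ) + 1) * Δ - s) - g (i * Δ - s)
  have hf : ∀ i, MemLp (f i) 2 volume := fun i => (hgt _).sub (hgt _)
  have hZW : ∀ i, BSS.IsWienerIntegral W P (f i) (Z i) := fun i =>
    (hXW _).sub hW (hgt _) (hgt _) (hXW _)
  have hZG := BSS.IsWienerIntegral.isGaussianProcess hW hf hZW
  have hZ0 : ∀ i, ∫ ω, Z i ω ∂P = 0 := fun i => (hZW i).integral_eq_zero hW (hf i)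
  have hcov : ∀ i j : ℕ, cov[Z i, Z j; P] = r ((i : ℤ) - j) := by
    intro i j
    have hXcov : ∀ t u, cov[X t, X u; P] = BSS.autocov g (t - u) := fun t u => by
      rw [(hXW t).covariance_eq hW (hgt t) (hgt u) (hXW u),
        BSS.integral_shift_mul_shift hg_zero]
    have hL : ∀ t, MemLp (X t) 2 P := fun t => (hXW t).1
    change cov[fun ω => X (((i : ℝ) + 1) * Δ) ω - X (i * Δ) ω,
      fun ω => X (((j : ℝ) + 1) * Δ) ω - X (j * Δ) ω; P] = _
    rw [covariance_fun_sub_fun_sub (hL _) (hL _) (hL _) (hL _)]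
    simp only [hXcov, hr_def, ha_def]
    push_cast
    ring_nf
  have hr0 : BSS.structureFn P X Δ = r 0 := by
    have h := hcov 0 0
    rw [covariance_self (hZG.aemeasurable 0), variance_eq_integral (hZG.aemeasurable 0), hZ0] at h
    simpa [Z, BSS.structureFn] using h
  have hr0pos : 0 < r 0 := by
    have h := (hZW 0).covariance_eq hW (hf 0) (hf 0) (hZW 0)
    rw [hcov] at h
    simp only [Nat.cast_zero, sub_self] at h
    rw [h]
    simpa [f, sq] using BSS.integral_sq_shift_sub_pos hg_L2 hg_zero hg_ne hΔ
  have hclt := BSS.tendstoInDistribution_sum_sq hZG hZ0 hcov hr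
  let A : ℕ → Ω → ℝ := fun N ω => (1 / (N : ℝ)) * ∑ i ∈ Finset.range N, Z i ω ^ 2
  have hest : ∀ N ω, BSS.scaleEstimator X Δ N ω = √(A N ω) := by
    intro N ω
    have : ∑ i ∈ Finset.Icc 1 N, (X ((i : ℝ) * Δ) ω - X (((i : ℝ) - 1) * Δ) ω) ^ 2
        = ∑ i ∈ Finset.range N, Z i ω ^ 2 := by
      rw [← Finset.Ico_add_one_right_eq_Icc, Finset.sum_Ico_eq_sum_range, Nat.add_sub_cancel]
      refine Finset.sum_congr rfl fun i _ => ?_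
      simp only [Z]
      push_cast
      ring_nf
    rw [BSS.scaleEstimator, this]
  have hfac : BSS.scaleFactor P X Δ = √(r 0) := by rw [BSS.scaleFactor, hr0]
  have hA : TendstoInDistribution (fun (N : ℕ) ω => √(N : ℝ) * (A N ω - r 0)) atTop (id : ℝ → ℝ)
      (fun _ => P) (gaussianReal 0 (BSS.asympVar g Δ).toNNReal) := by
    rw [hvar]
    refine hclt.congr (fun N => ae_of_all _ fun ω => ?_) ae_eq_rfl
    -- At `N = 0` both sides vanish, since `√0 = 0` and `0⁻¹ = 0`.
    rcases Nat.eq_zero_or_pos N with rfl | hN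
    · simp
    have hN' : (0 : ℝ) < N := by exact_mod_cast hN
    have hs := Real.sq_sqrt hN'.le
    have hs0 : √(N : ℝ) ≠ 0 := (Real.sqrt_pos.2 hN').ne'
    simp only [A, Finset.sum_sub_distrib, Finset.sum_const, Finset.card_range, nsmul_eq_mul]
    rw [inv_mul_eq_iff_eq_mul₀ hs0, ← mul_assoc, ← sq, hs]
    field_simp
  have hfin := BSS.tendstoInDistribution_sqrt hr0pos
    (fun N ω => mul_nonneg (by positivity) (Finset.sum_nonneg fun _ _ => sq_nonneg _)) hA
    (fun N => .const_mul (Finset.aemeasurable_fun_sum _ fun i _ =>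
      (hZG.aemeasurable i).pow_const 2) _)
  simp_rw [hest, hfac, Real.sq_sqrt hr0pos.le]
  refine ⟨Real.sqrt_pos.2 hr0pos, ?_, ?_, ?_, hv0, hfin.1, hfin.2⟩
  · rw [ht00]
    exact ha.mul_left 2
  · rw [ht01]
    exact h01.mul_left 2
  · rw [ht11]
    exact ha.add h11
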